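/- Let $n\ge 2$, let $\Omega\subseteq\mathbb R^n$ be open, and let $X$ be a vector field on $\Omega$ with a Hamiltonian realization on $\Omega$, i.e. there are $\nu,C_1,\dots,C_{n-2},H\in C^\infty(\Omega,\mathbb R)$ with $$X=\sum_{i=1}^n \nu\cdot\frac{\partial(C_1,\dots,C_{n-2},x_i,H)}{\partial(x_1,\dots,x_n)}\,\frac{\partial}{\partial x_i}\quad\text{on }\Omega .$$ A point $\overline x_e\in\Omega$ is a regular equilibrium of this realization if $\nu(\overline x_e)\ne0$, the vectors $\nabla C_1(\overline x_e),\dots,\nabla C_{n-2}(\overline x_e)$ are linearly independent, and $\nabla C_1(\overline x_e),\dots,\nabla C_{n-2}(\overline x_e),\nabla H(\overline x_e)$ are linearly dependent. Then there is a unique $(\lambda_1,\dots,\lambda_{n-2})\in\mathbb R^{n-2}$ with $\nabla H(\overline x_e)+\sum_j\lambda_j\nabla C_j(\overline x_e)=0$; put $F=H+\sum_j\lambda_jC_j$ and let $\operatorname{Hess}F=\mathrm D(\nabla F)$. The regular equilibrium is non-degenerate if $\det\operatorname{Hess}F(\overline x_e)\neq0$, and then one sets $$\mathcal I_X(\overline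 x_e):=\nu(\overline x_e)^2\cdot\det\operatorname{Hess}F(\overline x_e)\cdot\det\Big(\big\langle[\operatorname{Hess}F(\overline x_e)]^{-1}\nabla C_i(\overline x_e),\nabla C_j(\overline x_e)\big\rangle\Big)_{1\le i,j\le n-2}$$ (the last determinant is $1$ if $n=2$). Let $\overline x_e$ be a non-degenerate regular equilibrium of such a realization of $X$. 1. The linearization $\mathfrak L^X(\overline x_e)v=\frac{\mathrm d}{\mathrm dt}\big(\mathrm DF^X_t(\overline x_e)v\big)\big|_{t=0}$, where $F^X_t$ is the (local) flow of $X$, is a well-defined linear map $\mathbb R^n\to\mathbb R^n$, and its characteristic polynomial is $$\det\big(\mathfrak L^X(\overline x_e)-\mu I_n\big)=(-\mu)^{n-2}\big(\mu^2+\mathcal I_X(\overline x_e)\big).$$ 2. $\mathcal I_X(\overline x_e)$ depends only on $X$ and $\overline x_e$: if $\overline x_e$ is also a non-degenerate regular equilibrium of another Hamiltonian realization $\nu',C'_1,\dots,C'_{n-2},H'$ of $X$, possibly on another open set $\Omega'\ni\overline x_e$, then the number $\mathcal I_X(\overline x_e)$ computed from it is the same. 3. If $\mathcal I_X(\overline x_e)<0$,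 then $\overline x_e$ is an unstable equilibrium of $X$: $X(\overline x_e)=0$, and $\overline x_e$ is not Lyapunov stable. Here $\overline x_e$ is Lyapunov stable if every open neighbourhood $U\subseteq\Omega$ of $\overline x_e$ contains an open neighbourhood $V$ of $\overline x_e$ such that $F^X_t(\overline x)$ is defined and lies in $U$ for all $\overline x\in V$ and all $t\ge0$. -/

import Mathlib

open scoped ContDiff

noncomputable section

namespace CompletelyIntegrable

/-- Euclidean space `ℝⁿ` with its canonical inner product. -/
abbrev E (n : ℕ) : Type := EuclideanSpace ℝ (Fin n)

/-- The Jacobian determinant `∂(f₁,…,fₙ)/∂(x₁,…,xₙ)` at the point `x`. -/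
def jacobianDet {n : ℕ} (f : Fin n → E n → ℝ) (x : E n) : ℝ :=
  Matrix.det (Matrix.of fun i j : Fin n => fderiv ℝ (f i) x (EuclideanSpace.single j (1 : ℝ)))

/-- The vector field whose `i`-th component is `ν · ∂(C₁,…,C_{n-2},xᵢ,H)/∂(x₁,…,xₙ)`,
where `n = m + 2`. -/
def hamiltonianField {m : ℕ} (ν : E (m + 2) → ℝ) (C : Fin m → E (m + 2) → ℝ)
    (H : E (m + 2) → ℝ) (x : E (m + 2)) : E (m + 2) :=
  WithLp.toLp 2 fun i : Fin (m + 2) =>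
    ν x * jacobianDet
      (Fin.snoc (α := fun _ => E (m + 2) → ℝ)
        (Fin.snoc (α := fun _ => E (m + 2) → ℝ) C (fun y => y i)) H) x

/-- A Hamiltonian realization, on the open set `Ω ⊆ ℝⁿ` with `n = m + 2`, of the vector field `X`:
smooth functions `ν`, `C₁, …, C_{n-2}` and `H = C_{n-1}` on `Ω` such that
`X = ∑ᵢ ν · ∂(C₁,…,C_{n-2},xᵢ,H)/∂(x₁,…,xₙ) · ∂/∂xᵢ` on `Ω`. -/
structure Realization {m : ℕ} (Ω : Set (E (m + 2))) (X : E (m + 2) → E (m + 2)) where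
  /-- the rescaling function -/
  ν : E (m + 2) → ℝ
  /-- the Casimir functions `C₁, …, C_{n-2}` -/
  C : Fin m → E (m + 2) → ℝ
  /-- the Hamiltonian `H = C_{n-1}` -/
  H : E (m + 2) → ℝ
  isOpen : IsOpen Ω
  smooth_ν : ContDiffOn ℝ ∞ ν Ω
  smooth_C : ∀ j, ContDiffOn ℝ ∞ (C j) Ω
  smooth_H : ContDiffOn ℝ ∞ H Ω
  field_eq : ∀ x ∈ Ω, X x = hamiltonianField ν C H x

/-- The Hessian operator `Hess F (x) = D(∇F)(x)`. -/
def hess {n : ℕ} (F : E n → ℝ) (x : E n) : E n →L[ℝ] E n :=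
  fderiv ℝ (gradient F) x

/-- The inner product `⟨u₁ ∧ … ∧ uₖ, v₁ ∧ … ∧ vₖ⟩ₖ = det [⟨uᵢ, vⱼ⟩]` of two decomposable
`k`-vectors. For `k = 0` it is `1`. -/
def wedgeInner {n k : ℕ} (u v : Fin k → E n) : ℝ :=
  Matrix.det (Matrix.of fun i j : Fin k => inner ℝ (u i) (v j))

namespace Realization

variable {m : ℕ} {Ω : Set (E (m + 2))} {X : E (m + 2) → E (m + 2)}

/-- `x` is a regular equilibrium of the realization: `x ∈ Ω`, `ν(x) ≠ 0`,
`∇C₁(x), …, ∇C_{n-2}(x)` are linearly independent (their wedge product is not zero) and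
`∇C₁(x), …, ∇C_{n-2}(x), ∇H(x)` are linearly dependent (their wedge product is zero). -/
structure IsRegularEquilibrium (R : Realization Ω X) (x : E (m + 2)) : Prop where
  mem : x ∈ Ω
  ν_ne_zero : R.ν x ≠ 0
  indep : LinearIndependent ℝ (fun j : Fin m => gradient (R.C j) x)
  dep : ¬ LinearIndependent ℝ
    (Fin.snoc (α := fun _ => E (m + 2)) (fun j : Fin m => gradient (R.C j) x) (gradient R.H x))

/-- At a regular equilibrium there is exactly one `lam = (λ₁, …, λ_{n-2})` with
`∇H(x) + λ₁ ∇C₁(x) + ⋯ + λ_{n-2} ∇C_{n-2}(x) = 0`. -/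
theorem IsRegularEquilibrium.existsUnique_multiplier {R : Realization Ω X} {x : E (m + 2)}
    (hx : R.IsRegularEquilibrium x) :
    ∃! lam : Fin m → ℝ, gradient R.H x + ∑ j, lam j • gradient (R.C j) x = 0 := by
  have hspan : gradient R.H x ∈
      Submodule.span ℝ (Set.range fun j : Fin m => gradient (R.C j) x) := by
    by_contra hn
    exact hx.dep (linearIndependent_finSnoc.2 ⟨hx.indep, hn⟩)
  obtain ⟨c, hc⟩ := (Submodule.mem_span_range_iff_exists_fun ℝ).1 hspan
  refine ⟨-c, ?_, ?_⟩
  · simp [← hc]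
  · intro lam hlam
    have h0 : ∑ j, (lam j + c j) • gradient (R.C j) x = 0 := by
      simp only [add_smul, Finset.sum_add_distrib, hc]
      exact (add_comm _ _).trans hlam
    funext j
    have := Fintype.linearIndependent_iff.1 hx.indep _ h0 j
    simp only [Pi.neg_apply]
    linarith

/-- The multipliers `λᵉ = (λᵉ₁, …, λᵉ_{n-2})` of a regular equilibrium. -/
def multiplier (R : Realization Ω X) {x : E (m + 2)} (hx : R.IsRegularEquilibrium x) :
    Fin m → ℝ :=
  hx.existsUnique_multiplier.choose

/-- The function `F_{λᵉ} = H + λᵉ₁ C₁ + ⋯ + λᵉ_{n-2} C_{n-2}` of a regular equilibrium. -/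
def lagrangian (R : Realization Ω X) {x : E (m + 2)} (hx : R.IsRegularEquilibrium x) :
    E (m + 2) → ℝ :=
  fun y => R.H y + ∑ j, R.multiplier hx j * R.C j y

/-- A regular equilibrium is a critical point of its function `F_{λᵉ}`. -/
theorem gradient_lagrangian (R : Realization Ω X) {x : E (m + 2)}
    (hx : R.IsRegularEquilibrium x) : gradient (R.lagrangian hx) x = 0 := by
  have hΩ : Ω ∈ nhds x := R.isOpen.mem_nhds hx.mem
  have hH : DifferentiableAt ℝ R.H x := (R.smooth_H.contDiffAt hΩ).differentiableAt (by simp)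
  have hC : ∀ j, DifferentiableAt ℝ (R.C j) x := fun j =>
    ((R.smooth_C j).contDiffAt hΩ).differentiableAt (by simp)
  have hd : HasFDerivAt (R.lagrangian hx)
      (fderiv ℝ R.H x + ∑ j, R.multiplier hx j • fderiv ℝ (R.C j) x) x :=
    hH.hasFDerivAt.add (HasFDerivAt.fun_sum fun j _ => (hC j).hasFDerivAt.const_mul _)
  have h : gradient R.H x + ∑ j, R.multiplier hx j • gradient (R.C j) x = 0 :=
    hx.existsUnique_multiplier.choose_spec.1
  unfold gradient at h ⊢
  rw [hd.fderiv]
  generalize R.multiplier hx = lam at h ⊢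
  simpa using h

/-- A regular equilibrium is non-degenerate if `det Hess F_{λᵉ} (x) ≠ 0` (`x` is always a
critical point of `F_{λᵉ}`, by `gradient_lagrangian`). -/
def IsNondegenerate (R : Realization Ω X) {x : E (m + 2)} (hx : R.IsRegularEquilibrium x) : Prop :=
  (hess (R.lagrangian hx) x).det ≠ 0

/-- The scalar `I_X(x) = ν(x)² · det (Hess F (x)) ·
⟨Hess F (x)⁻¹ ∇C₁(x) ∧ … ∧ Hess F (x)⁻¹ ∇C_{n-2}(x), ∇C₁(x) ∧ … ∧ ∇C_{n-2}(x)⟩_{n-2}`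
of a non-degenerate regular equilibrium, where `F = F_{λᵉ}`. -/
def invariant (R : Realization Ω X) {x : E (m + 2)} (hx : R.IsRegularEquilibrium x) : ℝ :=
  (R.ν x) ^ 2 * (hess (R.lagrangian hx) x).det *
    wedgeInner (fun j : Fin m => (hess (R.lagrangian hx) x).inverse (gradient (R.C j) x))
      (fun j : Fin m => gradient (R.C j) x)

end Realization

/-- `F` is a local flow of `X` around `xe`, defined on `(-ε, ε) × U` with values in `Ω`. -/
structure IsLocalFlow {n : ℕ} (Ω : Set (E n)) (X : E n → E n) (xe : E n)
    (ε : ℝ) (U : Set (E n)) (F : ℝ → E n → E n) : Prop where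
  ε_pos : 0 < ε
  isOpen : IsOpen U
  mem : xe ∈ U
  subset : U ⊆ Ω
  map_zero : ∀ x ∈ U, F 0 x = x
  map_mem : ∀ x ∈ U, ∀ t ∈ Set.Ioo (-ε) ε, F t x ∈ Ω
  hasDerivAt : ∀ x ∈ U, ∀ t ∈ Set.Ioo (-ε) ε, HasDerivAt (fun s => F s x) (X (F t x)) t

/-- `L` is the linearization of `X` at `xe`: `L v = d/dt (D F_t (xe) v)` at `t = 0`, where `F_t` is
the (local) flow of `X`. -/
def IsLinearizationAt {n : ℕ} (Ω : Set (E n)) (X : E n → E n) (xe : E n)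
    (L : E n →L[ℝ] E n) : Prop :=
  ∃ (ε : ℝ) (U : Set (E n)) (F : ℝ → E n → E n), IsLocalFlow Ω X xe ε U F ∧
    (∀ t ∈ Set.Ioo (-ε) ε, DifferentiableAt ℝ (F t) xe) ∧
    ∀ v : E n, HasDerivAt (fun t => fderiv ℝ (F t) xe v) (L v) 0

/-- Lyapunov stability: every open neighbourhood `U ⊆ Ω` of `xe` contains an open neighbourhood `V`
of `xe` such that the solution of `γ' = X(γ)` from any point of `V` exists and stays in `U` for all
times `t ≥ 0`. -/
def IsLyapunovStable {n : ℕ} (Ω : Set (E n)) (X : E n → E n) (xe : E n) : Prop :=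
  ∀ U : Set (E n), IsOpen U → xe ∈ U → U ⊆ Ω →
    ∃ V : Set (E n), IsOpen V ∧ xe ∈ V ∧ V ⊆ U ∧
      ∀ x ∈ V, ∃ γ : ℝ → E n, γ 0 = x ∧
        ∀ t : ℝ, 0 ≤ t → γ t ∈ U ∧ HasDerivWithinAt γ (X (γ t)) (Set.Ici 0) t

/-- An unstable equilibrium: an equilibrium which is not Lyapunov stable. -/
def IsUnstableEquilibrium {n : ℕ} (Ω : Set (E n)) (X : E n → E n) (xe : E n) : Prop :=
  X xe = 0 ∧ ¬ IsLyapunovStable Ω X xe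

end CompletelyIntegrable

end

/-! Adding multiples of the rows `∇C_j` to the last row of the Jacobian changes nothing, so `H` may
be replaced by `F` and `X = ν Π ∇F`, where `Π` is the skew matrix of `(v, u) ↦ det (∇C₁, …, ∇C_m, v,
u)`, `m = n - 2`. As `∇F` vanishes at `xe`, the derivative there is `A = ν Π S` with `S = Hess F`.

Let the rows of `c` be the `∇C_j` and those of `w` an orthonormal basis of the plane orthogonal to
them. Then `Π = κ wᵀ J w`, with `κ = det (c, w)` and `J` the standard symplectic matrix. Hence `A =
U V`, where `V U = ν κ J (w S wᵀ)` is a 2×2 matrix, traceless because `w S wᵀ` is symmetric. Since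
`U V` and `V U` share their nonzero spectrum, the characteristic polynomial of `A` is `(-μ)^m (μ² +
det (V U))`. Jacobi's identity for complementary minors, `stackDet_sq_mul_det`, turns `det (V U)`
into the invariant. As `A` is determined by `X` alone, so is the invariant.

At an equilibrium Grönwall's inequality shows that the flow has derivative `exp (tA)`, so the
linearization is `A`. If the invariant is negative, `A³ = lam² A` with `lam > 0` an eigenvalue, and
a quadratic Chetaev function forces orbits away (`not_isLyapunovStable_of_cube_eq`). -/

noncomputable section

namespace CompletelyIntegrable

/-! ### Grönwall estimates for solutions near a zero of a vector field -/

section LinearizedFlow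

open Set Filter Topology

variable {V : Type*} [NormedAddCommGroup V] [NormedSpace ℝ V]

/-- Solutions of `γ' = f(γ)` with `‖f y‖ ≤ K ‖y‖` near `0` grow at most exponentially as long as
the bound stays in the region where the estimate on `f` holds. -/
theorem norm_le_mul_exp_of_hasDerivAt {f : V → V} {K ρ T : ℝ}
    (hf : ∀ y, ‖y‖ ≤ ρ → ‖f y‖ ≤ K * ‖y‖) (hK : 0 ≤ K) {γ : ℝ → V}
    (hγ : ∀ t ∈ Icc 0 T, HasDerivAt γ (f (γ t)) t)
    (h0 : ‖γ 0‖ * Real.exp ((K + 1) * T) < ρ) {t : ℝ} (ht : t ∈ Icc 0 T) :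
    ‖γ t‖ ≤ ‖γ 0‖ * Real.exp ((K + 1) * t) := by
  -- The comparison theorem wants a strict inequality of derivatives at contact. The rate `K + 1` in
  -- place of `K` provides it once the barrier is positive; `r > ‖γ 0‖` ensures this even when `γ 0
  -- = 0`, and at the end `r` tends to `‖γ 0‖`.
  have key : ∀ r, ‖γ 0‖ < r → r * Real.exp ((K + 1) * T) < ρ →
      ‖γ t‖ ≤ r * Real.exp ((K + 1) * t) := by
    intro r hr hrρ
    have hr0 : 0 < r := (norm_nonneg _).trans_lt hr
    refine image_norm_le_of_norm_deriv_right_lt_deriv_boundary (f := γ) (f' := fun t => f (γ t))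
      (a := 0) (b := T) (B := fun t => r * Real.exp ((K + 1) * t))
      (B' := fun t => r * (Real.exp ((K + 1) * t) * ((K + 1) * 1)))
      (fun s hs => (hγ s hs).continuousAt.continuousWithinAt)
      (fun s hs => (hγ s (Ico_subset_Icc_self hs)).hasDerivWithinAt) (by simpa using hr.le)
      (fun s => (((hasDerivAt_id s).const_mul (K + 1)).exp).const_mul r) ?_ ht
    intro s hs hsB
    have hmono : r * Real.exp ((K + 1) * s) ≤ r * Real.exp ((K + 1) * T) := by
      have := hs.2.le
      gcongr
    have h1 := hf (γ s) (by rw [hsB]; linarith)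
    have hpos : 0 < r * Real.exp ((K + 1) * s) := by positivity
    rw [hsB] at h1
    nlinarith
  have hlim : Tendsto (fun r => r * Real.exp ((K + 1) * t)) (𝓝[>] ‖γ 0‖)
      (𝓝 (‖γ 0‖ * Real.exp ((K + 1) * t))) :=
    ((continuous_id.mul continuous_const).tendsto _).mono_left nhdsWithin_le_nhds
  have hev : ∀ᶠ r in 𝓝[>] ‖γ 0‖, r * Real.exp ((K + 1) * T) < ρ :=
    (((continuous_id.mul continuous_const).tendsto ‖γ 0‖).mono_left nhdsWithin_le_nhds).eventually
      (gt_mem_nhds h0)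
  refine ge_of_tendsto hlim ?_
  filter_upwards [hev, self_mem_nhdsWithin] with r h1 h2 using key r h2 h1

theorem norm_sub_le_of_hasFDerivAt_zero {f : V → V} {A : V →L[ℝ] V} (hf : HasFDerivAt f A 0)
    (hf0 : f 0 = 0) {η : ℝ} (hη : 0 < η) :
    ∃ ρ > 0, ∀ y, ‖y‖ ≤ ρ → ‖f y - A y‖ ≤ η * ‖y‖ := by
  have h := (hasFDerivAt_iff_isLittleO_nhds_zero.1 hf).def hη
  obtain ⟨ρ, hρ, h⟩ := Metric.eventually_nhds_iff_ball.1 h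
  refine ⟨ρ / 2, by positivity, fun y hy => ?_⟩
  simpa [hf0] using h y (by simp; linarith)

theorem norm_le_of_norm_sub_le {f : V → V} {A : V →L[ℝ] V} {η ρ : ℝ}
    (h : ∀ y, ‖y‖ ≤ ρ → ‖f y - A y‖ ≤ η * ‖y‖) (y : V) (hy : ‖y‖ ≤ ρ) :
    ‖f y‖ ≤ (‖A‖ + η) * ‖y‖ := by
  have h1 := h y hy
  have h2 := A.le_opNorm y
  have h3 := norm_add_le (f y - A y) (A y)
  rw [sub_add_cancel] at h3
  linarith

/-- Solutions starting close to a zero of a differentiable vector field stay close to it on a given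
time interval. -/
theorem exists_forall_norm_le_of_hasFDerivAt {f : V → V} {A : V →L[ℝ] V}
    (hf : HasFDerivAt f A 0) (hf0 : f 0 = 0) (T : ℝ) {δ : ℝ} (hδ : 0 < δ) :
    ∃ ρ > 0, ∀ γ : ℝ → V, ‖γ 0‖ ≤ ρ → ∀ t ∈ Icc 0 T,
      (∀ s ∈ Icc 0 t, HasDerivAt γ (f (γ s)) s) → ‖γ t‖ < δ := by
  obtain ⟨ρ, hρ, h⟩ := norm_sub_le_of_hasFDerivAt_zero hf hf0 one_pos
  have hK : 0 ≤ ‖A‖ + 1 := by positivity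
  set M := Real.exp ((‖A‖ + 1 + 1) * T)
  have hM : 0 < M := Real.exp_pos _
  have hm : 0 < min ρ δ := lt_min hρ hδ
  refine ⟨min ρ δ / M / 2, by positivity, fun γ h0 t ht hγ => ?_⟩
  have hle : Real.exp ((‖A‖ + 1 + 1) * t) ≤ M := Real.exp_le_exp.2 (by have := ht.2; gcongr)
  have h1 : ‖γ 0‖ * Real.exp ((‖A‖ + 1 + 1) * t) < min ρ δ := by
    calc ‖γ 0‖ * Real.exp ((‖A‖ + 1 + 1) * t) ≤ min ρ δ / M / 2 * M := by gcongr
      _ = min ρ δ / 2 := by field_simp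
      _ < _ := by linarith
  exact (norm_le_mul_exp_of_hasDerivAt (norm_le_of_norm_sub_le h) hK hγ
    (h1.trans_le (min_le_left _ _)) ⟨ht.1, le_rfl⟩).trans_lt (h1.trans_le (min_le_right _ _))

/-- Homogeneity in the inhomogeneous term: it makes the Grönwall error proportional to `‖γ 0‖`. -/
theorem gronwallBound_zero_left (K ε x : ℝ) :
    gronwallBound 0 K ε x = ε * gronwallBound 0 K 1 x := by
  unfold gronwallBound
  split_ifs <;> ring

/-- Near a zero of a differentiable vector field, the solutions are approximated to first order by
those of the linearized equation. -/
theorem exists_forall_norm_sub_exp_le [CompleteSpace V] {f : V → V} {A : V →L[ℝ] V}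
    (hf : HasFDerivAt f A 0) (hf0 : f 0 = 0) {T : ℝ} (hT : 0 ≤ T) {η : ℝ} (hη : 0 < η) :
    ∃ ρ > 0, ∀ γ : ℝ → V, ‖γ 0‖ ≤ ρ → (∀ t ∈ Icc 0 T, HasDerivAt γ (f (γ t)) t) →
      ‖γ T - NormedSpace.exp (T • A) (γ 0)‖ ≤ η * ‖γ 0‖ := by
  set M := Real.exp ((‖A‖ + 1 + 1) * T)
  have hM : 0 < M := Real.exp_pos _
  set G := |gronwallBound 0 ‖A‖ 1 T|
  have hG : 0 ≤ G := abs_nonneg _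
  -- The bound by `1` makes the growth factor `M` independent of `η'`; the other term absorbs `M`
  -- and the Grönwall constant. `G + 1` avoids dividing by zero.
  set η' := min 1 (η / (M * (G + 1)))
  have hη' : 0 < η' := lt_min one_pos (by positivity)
  obtain ⟨ρ, hρ, h⟩ := norm_sub_le_of_hasFDerivAt_zero hf hf0 hη'
  refine ⟨ρ / M / 2, by positivity, fun γ h0 hγ => ?_⟩
  have hK : 0 ≤ ‖A‖ + 1 := by positivity
  have h1 : ‖γ 0‖ * Real.exp ((‖A‖ + 1 + 1) * T) < ρ := by
    calc ‖γ 0‖ * M ≤ ρ / M / 2 * M := by gcongr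
      _ = ρ / 2 := by field_simp
      _ < _ := by linarith
  have hfK : ∀ y, ‖y‖ ≤ ρ → ‖f y‖ ≤ (‖A‖ + 1) * ‖y‖ := fun y hy =>
    (norm_le_of_norm_sub_le h y hy).trans (by gcongr; exact min_le_left _ _)
  have hgrow : ∀ t ∈ Icc 0 T, ‖γ t‖ ≤ ‖γ 0‖ * M := fun t ht =>
    (norm_le_mul_exp_of_hasDerivAt hfK hK hγ h1 ht).trans
      (by have := ht.2; gcongr; exact Real.exp_le_exp.2 (by gcongr))
  have hder : ∀ t ∈ Icc 0 T, HasDerivAt (fun t => γ t - NormedSpace.exp (t • A) (γ 0))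
      (f (γ t) - A (NormedSpace.exp (t • A) (γ 0))) t := fun t ht =>
    (hγ t ht).sub ((hasDerivAt_exp_smul_const' A t).clm_apply (hasDerivAt_const t (γ 0)) |>.congr_deriv
      (by simp))
  have hgr := norm_le_gronwallBound_of_norm_deriv_right_le (δ := 0) (K := ‖A‖)
    (ε := η' * (‖γ 0‖ * M))
    (fun t ht => (hder t ht).continuousAt.continuousWithinAt)
    (fun t ht => (hder t (Ico_subset_Icc_self ht)).hasDerivWithinAt) (by simp) (fun t ht => by
      have ht' := Ico_subset_Icc_self ht
      have e : f (γ t) - A (NormedSpace.exp (t • A) (γ 0)) =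
          A (γ t - NormedSpace.exp (t • A) (γ 0)) + (f (γ t) - A (γ t)) := by
        rw [map_sub]; abel
      rw [e]
      refine (norm_add_le _ _).trans (add_le_add (A.le_opNorm _) ?_)
      have h2 := hgrow t ht'
      refine (h (γ t) (h2.trans h1.le)).trans ?_
      gcongr) T ⟨hT, le_rfl⟩
  refine hgr.trans ?_
  rw [gronwallBound_zero_left, sub_zero]
  calc η' * (‖γ 0‖ * M) * gronwallBound 0 ‖A‖ 1 T ≤ η / (M * (G + 1)) * (‖γ 0‖ * M) * (G + 1) := by
        have e1 : gronwallBound 0 ‖A‖ 1 T ≤ G + 1 := (le_abs_self _).trans (by simp [G])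
        have e2 : η' ≤ η / (M * (G + 1)) := min_le_right _ _
        calc _ ≤ η' * (‖γ 0‖ * M) * (G + 1) := by gcongr
          _ ≤ _ := by gcongr
    _ = η * ‖γ 0‖ := by field_simp

end LinearizedFlow

/-! ### Local flow at an equilibrium and its derivative -/

section Linearization

open Set Filter Topology

variable {n : ℕ} {Ω : Set (E n)} {X : E n → E n} {xe : E n} {A : E n →L[ℝ] E n}

theorem hasFDerivAt_shift (hA : HasFDerivAt X A xe) : HasFDerivAt (fun y => X (xe + y)) A 0 := by
  have : HasFDerivAt X A (xe + 0) := by simpa using hA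
  exact (hasFDerivAt_comp_add_left xe).2 this

/-- Time reversal of a local flow. -/
theorem IsLocalFlow.reverse {ε : ℝ} {U : Set (E n)} {F : ℝ → E n → E n}
    (hF : IsLocalFlow Ω X xe ε U F) :
    IsLocalFlow Ω (fun x => -X x) xe ε U (fun t => F (-t)) where
  ε_pos := hF.ε_pos
  isOpen := hF.isOpen
  mem := hF.mem
  subset := hF.subset
  map_zero x hx := by simpa using hF.map_zero x hx
  map_mem x hx t ht := hF.map_mem x hx (-t) ⟨by linarith [ht.2], by linarith [ht.1]⟩
  hasDerivAt x hx t ht := by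
    have h := hF.hasDerivAt x hx (-t) ⟨by linarith [ht.2], by linarith [ht.1]⟩
    simpa [Function.comp_def] using h.scomp t (hasDerivAt_neg t)

/-- The first-order comparison with `exp (tA)` is already the definition of differentiability of `F
t` at `xe`, so no smooth dependence on initial data is needed. Negative times follow by reversal. -/
theorem IsLocalFlow.hasFDerivAt_of_nonneg {ε : ℝ} {U : Set (E n)} {F : ℝ → E n → E n}
    (hF : IsLocalFlow Ω X xe ε U F) (hX : X xe = 0) (hA : HasFDerivAt X A xe) {t : ℝ}
    (h0 : 0 ≤ t) (ht : t < ε) : HasFDerivAt (F t) (NormedSpace.exp (t • A)) xe := by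
  have hsub : ∀ s ∈ Icc 0 t, s ∈ Ioo (-ε) ε := fun s hs =>
    ⟨by linarith [hs.1, hF.ε_pos], by linarith [hs.2]⟩
  have key : ∀ η > 0, ∀ᶠ x in 𝓝 xe,
      ‖F t x - xe - NormedSpace.exp (t • A) (x - xe)‖ ≤ η * ‖x - xe‖ := by
    intro η hη
    obtain ⟨ρ, hρ, h⟩ := exists_forall_norm_sub_exp_le (hasFDerivAt_shift hA)
      (by simpa using hX) h0 hη
    filter_upwards [hF.isOpen.mem_nhds hF.mem, Metric.closedBall_mem_nhds xe hρ] with x hxU hx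
    have := h (fun s => F s x - xe) (by simpa [hF.map_zero x hxU, dist_eq_norm] using hx)
      (fun s hs => by simpa using (hF.hasDerivAt x hxU s (hsub s hs)).sub_const xe)
    simpa [hF.map_zero x hxU] using this
  -- At `x = xe` the right-hand side of `key` is zero.
  have hfix : F t xe = xe := by
    have := (key 1 one_pos).self_of_nhds
    simpa [sub_eq_zero] using this
  refine HasFDerivAt.of_isLittleO (Asymptotics.IsLittleO.of_bound fun η hη => ?_)
  filter_upwards [key η hη] with x hx
  rwa [hfix]

/-- The derivative at an equilibrium of the flow is the exponential of the derivative of the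
vector field. -/
theorem IsLocalFlow.hasFDerivAt {ε : ℝ} {U : Set (E n)} {F : ℝ → E n → E n}
    (hF : IsLocalFlow Ω X xe ε U F) (hX : X xe = 0) (hA : HasFDerivAt X A xe) {t : ℝ}
    (ht : t ∈ Ioo (-ε) ε) : HasFDerivAt (F t) (NormedSpace.exp (t • A)) xe := by
  rcases le_total 0 t with h | h
  · exact hF.hasFDerivAt_of_nonneg hX hA h ht.2
  · have := hF.reverse.hasFDerivAt_of_nonneg (A := -A) (by simpa using hX) hA.neg
      (t := -t) (by linarith) (by linarith [ht.1])
    simpa using this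

theorem IsLocalFlow.hasDerivAt_fderiv {ε : ℝ} {U : Set (E n)} {F : ℝ → E n → E n}
    (hF : IsLocalFlow Ω X xe ε U F) (hX : X xe = 0) (hA : HasFDerivAt X A xe) (v : E n) :
    HasDerivAt (fun t => fderiv ℝ (F t) xe v) (A v) 0 := by
  have h : HasDerivAt (fun t : ℝ => NormedSpace.exp (t • A) v) (A v) 0 := by
    refine ((hasDerivAt_exp_smul_const' A (0 : ℝ)).clm_apply
      (hasDerivAt_const 0 v)).congr_deriv ?_
    have h0 : (0 : ℝ) • A = 0 := by ext; simp
    rw [h0, NormedSpace.exp_zero]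
    simp
  refine h.congr_of_eventuallyEq ?_
  filter_upwards [Ioo_mem_nhds (neg_lt_zero.2 hF.ε_pos) hF.ε_pos] with t ht
  rw [(hF.hasFDerivAt hX hA ht).fderiv]

/-- Every local flow, whichever one the definition supplies, has derivative `exp (tA)` at `xe`;
uniqueness of flows is not used. -/
theorem IsLinearizationAt.eq {L : E n →L[ℝ] E n} (hL : IsLinearizationAt Ω X xe L)
    (hX : X xe = 0) (hA : HasFDerivAt X A xe) : L = A := by
  obtain ⟨ε, U, F, hF, -, hd⟩ := hL
  ext1 v
  exact (hd v).unique (hF.hasDerivAt_fderiv hX hA v)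

/-- A `C¹` vector field has a local flow around each of its zeros. -/
theorem exists_isLocalFlow (hΩ : Ω ∈ 𝓝 xe) (hX : X xe = 0) (hc : ContDiffAt ℝ 1 X xe) :
    ∃ (ε : ℝ) (U : Set (E n)) (F : ℝ → E n → E n), IsLocalFlow Ω X xe ε U F := by
  obtain ⟨r, hr, ε, hε, H⟩ :=
    hc.exists_forall_mem_closedBall_exists_eq_forall_mem_Ioo_hasDerivAt 0
  simp only [zero_sub, zero_add] at H
  choose! α hα0 hα using H
  obtain ⟨δ, hδ, hδΩ⟩ := Metric.mem_nhds_iff.1 hΩ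
  have hA := hasFDerivAt_shift (hc.differentiableAt one_ne_zero).hasFDerivAt
  -- Picard–Lindelöf does not say that the solutions stay in `Ω`. The growth estimates for `X` and
  -- for the time-reversed field `-X` keep them in the `δ`-ball in both time directions.
  obtain ⟨ρ₁, hρ₁, h₁⟩ := exists_forall_norm_le_of_hasFDerivAt hA (by simpa using hX) ε hδ
  obtain ⟨ρ₂, hρ₂, h₂⟩ := exists_forall_norm_le_of_hasFDerivAt hA.neg (by simpa using hX) ε hδ
  set ρ := min (min r δ) (min ρ₁ ρ₂)
  have hρ : 0 < ρ := by positivity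
  have hball : ∀ x ∈ Metric.ball xe ρ, x ∈ Metric.closedBall xe r := fun x hx =>
    Metric.mem_closedBall.2 ((Metric.mem_ball.1 hx).le.trans
      ((min_le_left _ _).trans (min_le_left _ _)))
  refine ⟨ε, Metric.ball xe ρ, fun t x => α x t, hε, Metric.isOpen_ball,
    Metric.mem_ball_self hρ, ?_, fun x hx => hα0 x (hball x hx), ?_,
    fun x hx t ht => hα x (hball x hx) t ht⟩
  · exact (Metric.ball_subset_ball ((min_le_left _ _).trans (min_le_right _ _))).trans hδΩ
  · intro x hx t ht
    apply hδΩ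
    have hnorm : ‖x - xe‖ < ρ := by simpa [dist_eq_norm] using hx
    rw [Metric.mem_ball, dist_eq_norm]
    have hx' := hball x hx
    rcases le_total 0 t with h | h
    · refine h₁ (fun s => α x s - xe) ?_ t ⟨h, ht.2.le⟩ fun s hs => ?_
      · simpa [hα0 x hx'] using
          hnorm.le.trans ((min_le_right _ _).trans (min_le_left _ _))
      · simpa using (hα x hx' s ⟨by linarith [hs.1], by linarith [hs.2, ht.2]⟩).sub_const xe
    · have := h₂ (fun s => α x (-s) - xe) ?_ (-t) ⟨by linarith, by linarith [ht.1]⟩ fun s hs => ?_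
      · simpa using this
      · simpa [hα0 x hx'] using
          hnorm.le.trans ((min_le_right _ _).trans (min_le_right _ _))
      · have h' := hα x hx' (-s) ⟨by linarith [hs.2, ht.1], by linarith [hs.1]⟩
        simpa using (h'.scomp s (hasDerivAt_neg s)).sub_const xe

theorem isLinearizationAt_of_hasFDerivAt (hΩ : Ω ∈ 𝓝 xe) (hX : X xe = 0)
    (hc : ContDiffAt ℝ 1 X xe) (hA : HasFDerivAt X A xe) : IsLinearizationAt Ω X xe A := by
  obtain ⟨ε, U, F, hF⟩ := exists_isLocalFlow hΩ hX hc
  exact ⟨ε, U, F, hF, fun t ht => (hF.hasFDerivAt hX hA ht).differentiableAt,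
    hF.hasDerivAt_fderiv hX hA⟩

end Linearization

/-! ### Chetaev instability argument -/

section Instability

open Set Filter Topology

/-- The estimate behind the Chetaev function `‖p‖² - ‖q‖² - ‖z‖²` for a perturbation `e` of the
linear field acting as `lam`, `-lam`, `0` on the three components `p`, `q`, `z`. -/
theorem chetaev_estimate {V : Type*} [NormedAddCommGroup V] [InnerProductSpace ℝ V]
    {p q z e₁ e₂ e₃ : V} {lam κ : ℝ} (hlam : 0 < lam) (hκ : 12 * κ ≤ lam)
    (h₁ : ‖e₁‖ ≤ κ * (‖p‖ + ‖q‖ + ‖z‖)) (h₂ : ‖e₂‖ ≤ κ * (‖p‖ + ‖q‖ + ‖z‖))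
    (h₃ : ‖e₃‖ ≤ κ * (‖p‖ + ‖q‖ + ‖z‖)) (hpos : 0 < ‖p‖ ^ 2 - ‖q‖ ^ 2 - ‖z‖ ^ 2) :
    lam / 4 * (‖p‖ ^ 2 - ‖q‖ ^ 2 - ‖z‖ ^ 2) <
      2 * inner ℝ p (lam • p + e₁) - 2 * inner ℝ q (-(lam • q) + e₂) - 2 * inner ℝ z e₃ := by
  have i₁ : -(‖p‖ * (κ * (‖p‖ + ‖q‖ + ‖z‖))) ≤ inner ℝ p e₁ :=
    (neg_le_neg (by gcongr)).trans (abs_le.1 (abs_real_inner_le_norm p e₁)).1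
  have i₂ : inner ℝ q e₂ ≤ ‖q‖ * (κ * (‖p‖ + ‖q‖ + ‖z‖)) :=
    (abs_le.1 (abs_real_inner_le_norm q e₂)).2.trans (by gcongr)
  have i₃ : inner ℝ z e₃ ≤ ‖z‖ * (κ * (‖p‖ + ‖q‖ + ‖z‖)) :=
    (abs_le.1 (abs_real_inner_le_norm z e₃)).2.trans (by gcongr)
  simp only [inner_add_right, inner_neg_right, inner_smul_right, real_inner_self_eq_norm_sq]
  set a := ‖p‖
  set b := ‖q‖
  set c := ‖z‖
  have hs : (a + b + c) ^ 2 ≤ 3 * (a ^ 2 + b ^ 2 + c ^ 2) := by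
    nlinarith [sq_nonneg (a - b), sq_nonneg (b - c), sq_nonneg (a - c)]
  -- The three error terms add up to `2κ(a + b + c)²`; with the factor `3` of `hs` this is where the
  -- constant `12` comes from.
  have hs' : 2 * κ * (a + b + c) ^ 2 ≤ lam / 2 * (a ^ 2 + b ^ 2 + c ^ 2) := by
    nlinarith [sq_nonneg (a + b + c)]
  nlinarith [mul_pos hlam hpos, mul_nonneg hlam.le (sq_nonneg b), mul_nonneg hlam.le (sq_nonneg c)]

/-- An equilibrium at which the derivative `A` of the vector field satisfies `A³ = lam² A` and has
the positive eigenvalue `lam` is not Lyapunov stable. -/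
theorem not_isLyapunovStable_of_cube_eq {n : ℕ} {Ω : Set (E n)} {X : E n → E n} {xe : E n}
    {A : E n →L[ℝ] E n} (hΩ : Ω ∈ 𝓝 xe) (hX : X xe = 0) (hA : HasFDerivAt X A xe)
    {lam : ℝ} (hlam : 0 < lam) (hcube : ∀ y, A (A (A y)) = lam ^ 2 • A y)
    {v : E n} (hv : v ≠ 0) (hAv : A v = lam • v) : ¬ IsLyapunovStable Ω X xe := by
  intro hst
  -- Since `t³ - lam² t` has the simple roots `lam`, `-lam`, `0`, its Lagrange polynomials evaluated
  -- at `A` are the spectral projections `P`, `Q`, `Z`.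
  set P : E n →L[ℝ] E n := (1 / (2 * lam ^ 2)) • (A.comp A + lam • A) with hP
  set Q : E n →L[ℝ] E n := (1 / (2 * lam ^ 2)) • (A.comp A - lam • A) with hQ
  set Z : E n →L[ℝ] E n := ContinuousLinearMap.id ℝ (E n) - (1 / lam ^ 2) • A.comp A with hZ
  have hl : lam ≠ 0 := hlam.ne'
  have hPA : ∀ y, P (A y) = lam • P y := by
    intro y
    simp only [hP, smul_apply, add_apply,
      ContinuousLinearMap.comp_apply, hcube]
    module
  have hQA : ∀ y, Q (A y) = -(lam • Q y) := by
    intro y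
    simp only [hQ, smul_apply, sub_apply,
      ContinuousLinearMap.comp_apply, hcube]
    module
  have hZA : ∀ y, Z (A y) = 0 := by
    intro y
    simp only [hZ, smul_apply, sub_apply,
      ContinuousLinearMap.comp_apply, hcube, ContinuousLinearMap.id_apply, smul_smul]
    rw [one_div, inv_mul_cancel₀ (by positivity), one_smul, sub_self]
  have hsum : ∀ y, P y + Q y + Z y = y := by
    intro y
    simp only [hP, hQ, hZ, smul_apply, sub_apply,
      add_apply, ContinuousLinearMap.comp_apply, ContinuousLinearMap.id_apply]
    match_scalars <;> field_simp <;> ring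
  have hPv : P v = v := by
    simp only [hP, smul_apply, add_apply,
      ContinuousLinearMap.comp_apply, hAv, map_smul]
    match_scalars; field_simp; ring
  have hQv : Q v = 0 := by
    simp only [hQ, smul_apply, sub_apply,
      ContinuousLinearMap.comp_apply, hAv, map_smul]
    match_scalars; ring
  have hZv : Z v = 0 := by
    have := hsum v
    rwa [hPv, hQv, add_zero, add_eq_left] at this
  set M := ‖P‖ + ‖Q‖ + ‖Z‖ + 1
  have hM : 0 < M := by positivity
  have hPM : ‖P‖ ≤ M := by simp only [M]; linarith [norm_nonneg Q, norm_nonneg Z]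
  have hQM : ‖Q‖ ≤ M := by simp only [M]; linarith [norm_nonneg P, norm_nonneg Z]
  have hZM : ‖Z‖ ≤ M := by simp only [M]; linarith [norm_nonneg Q, norm_nonneg P]
  obtain ⟨ρ, hρ, hrem⟩ := norm_sub_le_of_hasFDerivAt_zero (hasFDerivAt_shift hA)
    (by simpa using hX) (η := lam / (12 * M)) (by positivity)
  obtain ⟨δ, hδ, hδΩ⟩ := Metric.mem_nhds_iff.1 hΩ
  obtain ⟨W, hWo, hxeW, -, hW⟩ := hst (Metric.ball xe (min ρ δ)) Metric.isOpen_ball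
    (Metric.mem_ball_self (lt_min hρ hδ))
    ((Metric.ball_subset_ball (min_le_right _ _)).trans hδΩ)
  -- The orbit starts on the unstable eigenline, where the Chetaev function `g` is positive.
  have hlim : Tendsto (fun s : ℝ => xe + s • v) (𝓝[>] 0) (𝓝 xe) := by
    have : Continuous (fun s : ℝ => xe + s • v) := by fun_prop
    simpa using (this.tendsto 0).mono_left nhdsWithin_le_nhds
  obtain ⟨s, hsW, hs0⟩ := ((hlim.eventually (hWo.mem_nhds hxeW)).and self_mem_nhdsWithin).exists
  obtain ⟨γ, hγ0, hγ⟩ := hW _ hsW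
  have hs0 : 0 < s := hs0
  set y : ℝ → E n := fun t => γ t - xe with hy
  set f : ℝ → E n := fun t => X (γ t) with hf
  have hyρ : ∀ t, 0 ≤ t → ‖y t‖ ≤ ρ := fun t ht => by
    have := (hγ t ht).1
    rw [Metric.mem_ball, dist_eq_norm] at this
    exact this.le.trans (min_le_left _ _)
  have hyd : ∀ t, 0 ≤ t → HasDerivWithinAt y (f t) (Ici 0) t := fun t ht =>
    (hγ t ht).2.sub_const xe
  set g : ℝ → ℝ := fun t => ‖P (y t)‖ ^ 2 - ‖Q (y t)‖ ^ 2 - ‖Z (y t)‖ ^ 2 with hg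
  have hgd : ∀ t, 0 ≤ t → HasDerivWithinAt g (2 * inner ℝ (P (y t)) (P (f t)) -
      2 * inner ℝ (Q (y t)) (Q (f t)) - 2 * inner ℝ (Z (y t)) (Z (f t))) (Ici 0) t := by
    intro t ht
    have h := hyd t ht
    exact (((P.hasFDerivAt.comp_hasDerivWithinAt t h).norm_sq).sub
      ((Q.hasFDerivAt.comp_hasDerivWithinAt t h).norm_sq)).sub
      ((Z.hasFDerivAt.comp_hasDerivWithinAt t h).norm_sq)
  have hest : ∀ t, 0 ≤ t → 0 < g t → lam / 4 * g t < 2 * inner ℝ (P (y t)) (P (f t)) -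
      2 * inner ℝ (Q (y t)) (Q (f t)) - 2 * inner ℝ (Z (y t)) (Z (f t)) := by
    intro t ht hgt
    set e := f t - A (y t)
    have he : ‖e‖ ≤ lam / (12 * M) * ‖y t‖ := by
      simpa only [e, hy, hf, add_sub_cancel] using hrem (y t) (hyρ t ht)
    have hfe : f t = A (y t) + e := by simp [e]
    have hyn : ‖y t‖ ≤ ‖P (y t)‖ + ‖Q (y t)‖ + ‖Z (y t)‖ := by
      conv_lhs => rw [← hsum (y t)]
      exact norm_add₃_le
    have hT : ∀ T : E n →L[ℝ] E n, ‖T‖ ≤ M →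
        ‖T e‖ ≤ lam / 12 * (‖P (y t)‖ + ‖Q (y t)‖ + ‖Z (y t)‖) := by
      intro T hT
      calc ‖T e‖ ≤ ‖T‖ * ‖e‖ := T.le_opNorm e
        _ ≤ M * (lam / (12 * M) * (‖P (y t)‖ + ‖Q (y t)‖ + ‖Z (y t)‖)) := by
            have := he.trans (mul_le_mul_of_nonneg_left hyn (by positivity))
            gcongr
        _ = _ := by field_simp
    rw [hfe, map_add, map_add, map_add, hPA, hQA, hZA, zero_add]
    exact chetaev_estimate hlam (by linarith) (hT P hPM) (hT Q hQM) (hT Z hZM) hgt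
  have hg0 : 0 < g 0 := by
    simp only [hg, hy, hγ0, add_sub_cancel_left, map_smul, hPv, hQv, hZv]
    have := norm_pos_iff.2 hv
    simp [norm_smul]
    positivity
  have hgrow : ∀ T, 0 ≤ T → g 0 * Real.exp (lam / 4 * T) ≤ g T := by
    intro T hT
    -- The derivatives are compared only where `g` meets the exponential barrier; there `g > 0`, so
    -- `hest` applies.
    have := image_le_of_deriv_right_lt_deriv_boundary (f := fun t => -g t)
      (a := 0) (b := T) (B := fun t => -(g 0 * Real.exp (lam / 4 * t)))
      (B' := fun t => -(g 0 * (Real.exp (lam / 4 * t) * (lam / 4 * 1))))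
      (fun t ht => ((hgd t ht.1).continuousWithinAt.mono Icc_subset_Ici_self).neg)
      (fun t ht => ((hgd t ht.1).mono (Ici_subset_Ici.2 ht.1)).neg) (by simp)
      (fun t => ((((hasDerivAt_id t).const_mul (lam / 4)).exp).const_mul (g 0)).neg)
      (fun t ht heq => by
        have heq' : g t = g 0 * Real.exp (lam / 4 * t) := neg_inj.1 heq
        have := hest t ht.1 (by rw [heq']; positivity)
        rw [heq'] at this
        refine neg_lt_neg (lt_of_eq_of_lt ?_ this)
        ring) (right_mem_Icc.2 hT)
    exact neg_le_neg_iff.1 this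
  have hbd : ∀ T, 0 ≤ T → g T ≤ (M * ρ) ^ 2 := by
    intro T hT
    have h1 : ‖P (y T)‖ ≤ M * ρ := (P.le_opNorm _).trans (by
      have := hyρ T hT
      gcongr)
    have h2 : ‖P (y T)‖ ^ 2 ≤ (M * ρ) ^ 2 := by gcongr
    simp only [hg]
    nlinarith [sq_nonneg ‖Q (y T)‖, sq_nonneg ‖Z (y T)‖]
  -- At this time the inequality `x + 1 ≤ exp x` makes the lower bound at least `(M * ρ) ^ 2 + g 0`,
  -- above the upper bound.
  set T := 4 / lam * ((M * ρ) ^ 2 / g 0)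
  have hT : 0 ≤ T := by positivity
  have h1 := (hgrow T hT).trans (hbd T hT)
  have h2 : lam / 4 * T = (M * ρ) ^ 2 / g 0 := by simp only [T]; field_simp
  rw [h2] at h1
  have h3 := mul_le_mul_of_nonneg_left (Real.add_one_le_exp ((M * ρ) ^ 2 / g 0)) hg0.le
  have h4 : g 0 * ((M * ρ) ^ 2 / g 0 + 1) = (M * ρ) ^ 2 + g 0 := by field_simp
  linarith

end Instability

/-! ### Bordered determinants and rank-two factorization -/

section Algebra

open Matrix

variable {m k : ℕ}

/-- The determinant of the square matrix with the rows of `c` followed by those of `w`. -/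
def stackDet (c : Matrix (Fin m) (Fin (m + k)) ℝ) (w : Matrix (Fin k) (Fin (m + k)) ℝ) : ℝ :=
  ((fromRows c w).submatrix finSumFinEquiv.symm id).det

/-- Multiplying one stacked matrix by the transpose of the other turns products of bordered
determinants into inner products of rows; orthogonality then kills off-diagonal blocks. -/
theorem stackDet_mul_stackDet (c c' : Matrix (Fin m) (Fin (m + k)) ℝ)
    (w w' : Matrix (Fin k) (Fin (m + k)) ℝ) :
    stackDet c w * stackDet c' w' =
      (fromBlocks (c * c'ᵀ) (c * w'ᵀ) (w * c'ᵀ) (w * w'ᵀ)).det := by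
  unfold stackDet
  rw [← det_transpose ((fromRows c' w').submatrix _ _), ← det_mul, transpose_submatrix,
    transpose_fromRows, ← submatrix_mul _ _ _ _ _ Function.bijective_id, fromRows_mul_fromCols,
    det_submatrix_equiv_self]

theorem stackDet_mul (c : Matrix (Fin m) (Fin (m + k)) ℝ) (w : Matrix (Fin k) (Fin (m + k)) ℝ)
    (S : Matrix (Fin (m + k)) (Fin (m + k)) ℝ) :
    stackDet (c * S) (w * S) = stackDet c w * S.det := by
  unfold stackDet
  rw [← det_mul, ← fromRows_mul]
  rfl

/-- Linearly independent rows admit an orthonormal complement. -/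
theorem exists_orthonormal_complement (c : Matrix (Fin m) (Fin (m + k)) ℝ)
    (hc : LinearIndependent ℝ c.row) :
    ∃ w : Matrix (Fin k) (Fin (m + k)) ℝ, w * wᵀ = 1 ∧ c * wᵀ = 0 := by
  set u : Fin m → E (m + k) := fun j => WithLp.toLp 2 (c j)
  have hu : LinearIndependent ℝ u :=
    hc.map' (WithLp.linearEquiv 2 ℝ (Fin (m + k) → ℝ)).symm.toLinearMap (LinearEquiv.ker _)
  set K := Submodule.span ℝ (Set.range u)
  have hK : Module.finrank ℝ K = m := by simpa using finrank_span_eq_card hu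
  have hK' : Module.finrank ℝ Kᗮ = k := by
    have := K.finrank_add_finrank_orthogonal
    rw [hK, finrank_euclideanSpace_fin] at this
    omega
  set b := (stdOrthonormalBasis ℝ Kᗮ).reindex (finCongr hK')
  refine ⟨Matrix.of fun i => ((b i : E (m + k)) : Fin (m + k) → ℝ), ?_, ?_⟩
  · ext i j
    have h := orthonormal_iff_ite.1 b.orthonormal i j
    rw [Submodule.coe_inner, PiLp.inner_apply] at h
    rw [mul_apply, one_apply, ← h]
    simp [mul_comm]
  · ext i j
    have h : inner ℝ (u i) (b j : E (m + k)) = 0 :=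
      (b j).2 (u i) (Submodule.subset_span ⟨i, rfl⟩)
    rw [PiLp.inner_apply] at h
    rw [mul_apply, Matrix.zero_apply, ← h]
    simp [u, mul_comm]

theorem det_mul_transpose_ne_zero (c : Matrix (Fin m) (Fin (m + k)) ℝ)
    (hc : LinearIndependent ℝ c.row) : (c * cᵀ).det ≠ 0 := by
  have hu : LinearIndependent ℝ (fun j => (WithLp.toLp 2 (c j) : E (m + k))) :=
    hc.map' (WithLp.linearEquiv 2 ℝ (Fin (m + k) → ℝ)).symm.toLinearMap (LinearEquiv.ker _)
  have h : c * cᵀ = gram ℝ fun j => (WithLp.toLp 2 (c j) : E (m + k)) := by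
    ext i j
    simp [mul_apply, gram_apply, PiLp.inner_apply, mul_comm]
  rw [h]
  exact det_gram_ne_zero_iff_linearIndependent.2 hu

theorem stackDet_sq (c : Matrix (Fin m) (Fin (m + k)) ℝ) (w : Matrix (Fin k) (Fin (m + k)) ℝ)
    (hw : w * wᵀ = 1) (hcw : c * wᵀ = 0) : stackDet c w ^ 2 = (c * cᵀ).det := by
  rw [sq, stackDet_mul_stackDet, hw, hcw, det_fromBlocks_zero₁₂, det_one, mul_one]

/-- Pairing with an orthonormal complement `w` of `c` evaluates `stackDet c`. -/
theorem stackDet_eq (c : Matrix (Fin m) (Fin (m + k)) ℝ) (w u : Matrix (Fin k) (Fin (m + k)) ℝ)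
    (hc : LinearIndependent ℝ c.row) (hw : w * wᵀ = 1) (hcw : c * wᵀ = 0) :
    stackDet c u = stackDet c w * (u * wᵀ).det := by
  have h1 := stackDet_sq c w hw hcw
  have h2 : stackDet c u * stackDet c w = (c * cᵀ).det * (u * wᵀ).det := by
    rw [stackDet_mul_stackDet, hcw, det_fromBlocks_zero₁₂]
  have h3 : stackDet c w ≠ 0 := fun h =>
    det_mul_transpose_ne_zero c hc (by rw [← h1, h]; ring)
  apply mul_right_cancel₀ h3
  rw [h2, ← h1]
  ring

/-- Complementary minors of a matrix and its inverse. -/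
theorem stackDet_sq_mul_det (c : Matrix (Fin m) (Fin (m + k)) ℝ)
    (w : Matrix (Fin k) (Fin (m + k)) ℝ) (S : Matrix (Fin (m + k)) (Fin (m + k)) ℝ)
    (hdet : S.det ≠ 0) (hw : w * wᵀ = 1) (hcw : c * wᵀ = 0) :
    stackDet c w ^ 2 * (w * S * wᵀ).det = S.det * (c * S⁻¹ * cᵀ).det := by
  have hu : IsUnit S.det := isUnit_iff_ne_zero.2 hdet
  have hwc : w * cᵀ = 0 := by simpa using congrArg transpose hcw
  have h1 := stackDet_sq c w hw hcw
  have h2 : stackDet (c * S⁻¹) w * stackDet c w = (c * S⁻¹ * cᵀ).det := by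
    rw [stackDet_mul_stackDet, hwc, hw, det_fromBlocks_zero₂₁, det_one, mul_one]
  have h3 : stackDet c (w * S) * stackDet c w = (c * cᵀ).det * (w * S * wᵀ).det := by
    rw [stackDet_mul_stackDet, hcw, det_fromBlocks_zero₁₂]
  -- The stack of `c` and `w * S` is the stack of `c * S⁻¹` and `w`, multiplied by `S`.
  have h4 : stackDet c (w * S) = stackDet (c * S⁻¹) w * S.det := by
    rw [← stackDet_mul, Matrix.mul_assoc c, nonsing_inv_mul _ hu, Matrix.mul_one]
  rw [h1, ← h3, h4, ← h2]
  ring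

/-- The skew-symmetric matrix of the pairing `(v, u) ↦ det (c₁, …, cₘ, v, u)`. -/
def pairingMatrix (c : Matrix (Fin m) (Fin (m + 2)) ℝ) : Matrix (Fin (m + 2)) (Fin (m + 2)) ℝ :=
  of fun i j => stackDet c (of ![Pi.single i 1, Pi.single j 1])

/-- By `stackDet_eq` the pairing sees only the components along the plane of `w`, where it is a
multiple of the 2×2 determinant. -/
theorem pairingMatrix_eq (c : Matrix (Fin m) (Fin (m + 2)) ℝ) (w : Matrix (Fin 2) (Fin (m + 2)) ℝ)
    (hc : LinearIndependent ℝ c.row) (hw : w * wᵀ = 1) (hcw : c * wᵀ = 0) :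
    pairingMatrix c = stackDet c w • (wᵀ * ((!![0, 1; -1, 0] : Matrix (Fin 2) (Fin 2) ℝ) * w)) := by
  ext i j
  rw [pairingMatrix, of_apply, stackDet_eq c w _ hc hw hcw, det_fin_two]
  simp [mul_apply, vecMul, dotProduct, Fin.sum_univ_two, Pi.single_apply]
  left
  ring

/-- The characteristic polynomials of `U * V` and `V * U` differ by the factor `X ^ m`, and that of
a traceless 2×2 matrix is `X² + det`. -/
theorem det_sub_smul_of_rank_two (U : Matrix (Fin (m + 2)) (Fin 2) ℝ)
    (V : Matrix (Fin 2) (Fin (m + 2)) ℝ) (htr : (V * U).trace = 0) (μ : ℝ) :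
    (U * V - μ • 1).det = (-μ) ^ m * (μ ^ 2 + (V * U).det) := by
  have h := congrArg (Polynomial.eval μ) (charpoly_mul_comm_of_le U V (by simp))
  rw [eval_charpoly, Polynomial.eval_mul, eval_charpoly] at h
  have h2 : (scalar (Fin 2) μ - V * U).det = μ ^ 2 + (V * U).det := by
    rw [trace_fin_two] at htr
    have : (V * U) 0 0 = -(V * U) 1 1 := by linarith
    simp only [det_fin_two, scalar_apply, Matrix.sub_apply, diagonal_apply_eq]
    simp [this]
    ring
  have h3 : (U * V - μ • 1).det = (-1) ^ (m + 2) * (scalar (Fin (m + 2)) μ - U * V).det := by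
    have : U * V - μ • 1 = -(scalar (Fin (m + 2)) μ - U * V) := by
      rw [neg_sub, scalar_apply, smul_one_eq_diagonal]
    rw [this, det_neg, Fintype.card_fin]
  rw [h3, h, h2]
  simp
  rw [neg_pow μ m]
  ring

/-- Cayley–Hamilton for the traceless 2×2 matrix `V * U`, placed between `U` and `V`. -/
theorem cube_of_rank_two (U : Matrix (Fin (m + 2)) (Fin 2) ℝ)
    (V : Matrix (Fin 2) (Fin (m + 2)) ℝ) (htr : (V * U).trace = 0) :
    (U * V) * ((U * V) * (U * V)) = -(V * U).det • (U * V) := by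
  have hsq : (V * U) * (V * U) = -(V * U).det • (1 : Matrix (Fin 2) (Fin 2) ℝ) := by
    rw [trace_fin_two] at htr
    have : (V * U) 0 0 = -(V * U) 1 1 := by linarith
    generalize V * U = M at this ⊢
    ext i j
    fin_cases i <;> fin_cases j <;> simp [mul_apply, Fin.sum_univ_two, det_fin_two, this] <;> ring
  calc (U * V) * ((U * V) * (U * V)) = U * ((V * U) * (V * U)) * V := by
        simp only [Matrix.mul_assoc]
    _ = _ := by rw [hsq]; simp

/-- The factorization of `a • pairingMatrix c * S` through the plane orthogonal to the rows of
`c`. -/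
theorem exists_rank_two_factorization (c : Matrix (Fin m) (Fin (m + 2)) ℝ)
    (hc : LinearIndependent ℝ c.row) (S : Matrix (Fin (m + 2)) (Fin (m + 2)) ℝ) (hS : Sᵀ = S)
    (hdet : S.det ≠ 0) (a : ℝ) :
    ∃ (U : Matrix (Fin (m + 2)) (Fin 2) ℝ) (V : Matrix (Fin 2) (Fin (m + 2)) ℝ),
      a • (pairingMatrix c * S) = U * V ∧ (V * U).trace = 0 ∧
        (V * U).det = a ^ 2 * S.det * (c * S⁻¹ * cᵀ).det := by
  obtain ⟨w, hw, hcw⟩ := exists_orthonormal_complement c hc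
  have key := stackDet_sq_mul_det c w S hdet hw hcw
  set κ := stackDet c w
  -- Here `V * U` is `a κ J (w S wᵀ)`: a skew matrix times a symmetric one has trace zero, and `key`
  -- evaluates `κ² det (w S wᵀ)`.
  refine ⟨wᵀ, (a * κ) • ((!![0, 1; -1, 0] : Matrix (Fin 2) (Fin 2) ℝ) * (w * S)), ?_, ?_, ?_⟩
  · rw [pairingMatrix_eq c w hc hw hcw]
    simp only [Matrix.mul_assoc, Matrix.smul_mul, Matrix.mul_smul, smul_smul, κ]
  · have hsym : (w * S * wᵀ) 0 1 = (w * S * wᵀ) 1 0 := by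
      have : (w * S * wᵀ)ᵀ = w * S * wᵀ := by simp [hS, Matrix.mul_assoc]
      exact congrFun (congrFun this 1) 0
    rw [Matrix.smul_mul, Matrix.mul_assoc, trace_smul, trace_fin_two, mul_apply, mul_apply]
    simp [Fin.sum_univ_two, hsym]
  · rw [Matrix.smul_mul, Matrix.mul_assoc, det_smul, det_mul, Fintype.card_fin,
      mul_assoc (a ^ 2), ← key]
    simp [det_fin_two_of]
    ring

end Algebra

/-! ### Jacobian determinant as a linear form in its last row -/

section FieldMatrix

open Matrix

variable {m : ℕ}

/-- Linearity of the bordered determinant in its last row. -/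
theorem exists_linearMap_stackDet (c : Matrix (Fin m) (Fin (m + 2)) ℝ) (v : Fin (m + 2) → ℝ) :
    ∃ f : (Fin (m + 2) → ℝ) →ₗ[ℝ] ℝ, ∀ h, stackDet c (of ![v, h]) = f h := by
  set M : Fin (m + 2) → Fin (m + 2) → ℝ :=
    fun i => fromRows c (of ![v, 0]) (finSumFinEquiv.symm i) with hM
  refine ⟨detRowAlternating.toMultilinearMap.toLinearMap M (finSumFinEquiv (Sum.inr 1)),
    fun h => ?_⟩
  change Matrix.det _ = Matrix.det (of (Function.update M (finSumFinEquiv (Sum.inr 1)) h))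
  congr 1
  ext i j
  obtain ⟨s, rfl⟩ := finSumFinEquiv.surjective i
  rcases s with s | s
  · rw [of_apply, Function.update_of_ne (finSumFinEquiv.injective.ne (by simp))]
    simp [hM]
  · fin_cases s
    · rw [of_apply, Function.update_of_ne (finSumFinEquiv.injective.ne (by simp))]
      simp [hM]
    · simp only [Fin.mk_one]
      rw [of_apply, Function.update_self]
      simp

theorem stackDet_pair_row (c : Matrix (Fin m) (Fin (m + 2)) ℝ) (v : Fin (m + 2) → ℝ) (k : Fin m) :
    stackDet c (of ![v, c k]) = 0 := by
  refine det_zero_of_row_eq (i := finSumFinEquiv (Sum.inl k)) (j := finSumFinEquiv (Sum.inr 1))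
    (finSumFinEquiv.injective.ne (by simp)) ?_
  ext j
  simp

/-- This lets `H` be replaced by `F` in the vector field at every point of `Ω`, not only at the
equilibrium. -/
theorem stackDet_pair_add_sum (c : Matrix (Fin m) (Fin (m + 2)) ℝ) (v h : Fin (m + 2) → ℝ)
    (lam : Fin m → ℝ) :
    stackDet c (of ![v, h + ∑ k, lam k • c k]) = stackDet c (of ![v, h]) := by
  obtain ⟨f, hf⟩ := exists_linearMap_stackDet c v
  have hk : ∀ k, f (c k) = 0 := fun k => by rw [← hf, stackDet_pair_row]
  simp [hf, hk]

theorem stackDet_single (c : Matrix (Fin m) (Fin (m + 2)) ℝ) (i : Fin (m + 2))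
    (h : Fin (m + 2) → ℝ) :
    stackDet c (of ![Pi.single i 1, h]) = ∑ j, pairingMatrix c i j * h j := by
  obtain ⟨f, hf⟩ := exists_linearMap_stackDet c (Pi.single i 1)
  rw [hf, f.pi_apply_eq_sum_univ]
  refine Finset.sum_congr rfl fun j _ => ?_
  rw [pairingMatrix, of_apply, hf, smul_eq_mul, mul_comm]
  congr 2
  ext l
  simp [Pi.single_apply, eq_comm]

theorem jacobianDet_snoc_snoc (C : Fin m → E (m + 2) → ℝ) (f g : E (m + 2) → ℝ) (x : E (m + 2)) :
    jacobianDet (Fin.snoc (α := fun _ => E (m + 2) → ℝ)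
        (Fin.snoc (α := fun _ => E (m + 2) → ℝ) C f) g) x =
      stackDet (of fun k j => fderiv ℝ (C k) x (EuclideanSpace.single j 1))
        (of ![fun j => fderiv ℝ f x (EuclideanSpace.single j 1),
          fun j => fderiv ℝ g x (EuclideanSpace.single j 1)]) := by
  unfold jacobianDet stackDet
  congr 1
  ext i j
  obtain ⟨s, rfl⟩ := (finSumFinEquiv (m := m) (n := 2)).surjective i
  rcases s with s | s
  · have h : (finSumFinEquiv (Sum.inl s) : Fin (m + 2)) = s.castSucc.castSucc := by ext; simp
    rw [submatrix_apply, Equiv.symm_apply_apply, h]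
    simp
  · rw [submatrix_apply, Equiv.symm_apply_apply]
    fin_cases s
    · have h : (finSumFinEquiv (Sum.inr 0) : Fin (m + 2)) = (Fin.last m).castSucc := by ext; simp
      simp [h]
    · have h : (finSumFinEquiv (Sum.inr 1) : Fin (m + 2)) = Fin.last (m + 1) := by ext; simp
      simp [h]

end FieldMatrix

/-! ### Gradients, Hessian matrices and smoothness -/

section Calculus

open Matrix Filter Topology

variable {n : ℕ}

theorem gradient_apply (f : E n → ℝ) (x : E n) (j : Fin n) :
    gradient f x j = fderiv ℝ f x (EuclideanSpace.single j 1) := by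
  rw [← inner_gradient_left, EuclideanSpace.inner_single_right]
  simp

theorem contDiffAt_gradient {f : E n → ℝ} {x : E n} (hf : ContDiffAt ℝ ∞ f x) :
    ContDiffAt ℝ ∞ (gradient f) x := by
  rw [contDiffAt_euclidean]
  intro j
  simp only [gradient_apply]
  exact (hf.fderiv_right (m := ∞) (by simp)).clm_apply contDiffAt_const

theorem contDiffAt_det {k : ℕ} {r : WithTop ℕ∞} {M : E n → Matrix (Fin k) (Fin k) ℝ} {x : E n}
    (h : ∀ i j, ContDiffAt ℝ r (fun y => M y i j) x) :
    ContDiffAt ℝ r (fun y => (M y).det) x := by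
  simp only [det_apply, Units.smul_def, zsmul_eq_mul]
  exact ContDiffAt.sum fun σ _ => contDiffAt_const.mul (contDiffAt_prod fun i _ => h _ _)

/-- The matrix of the Hessian operator. -/
def hessMatrix (f : E n → ℝ) (x : E n) : Matrix (Fin n) (Fin n) ℝ :=
  (toEuclideanCLM (𝕜 := ℝ) (n := Fin n)).symm (hess f x)

theorem toEuclideanCLM_hessMatrix (f : E n → ℝ) (x : E n) :
    toEuclideanCLM (𝕜 := ℝ) (n := Fin n) (hessMatrix f x) = hess f x :=
  StarAlgEquiv.apply_symm_apply _ _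

theorem hessMatrix_apply (f : E n → ℝ) (x : E n) (i j : Fin n) :
    hessMatrix f x i j = hess f x (EuclideanSpace.single j 1) i := by
  rw [← toEuclideanCLM_hessMatrix, ofLp_toEuclideanCLM]
  simp

/-- The coordinates of the gradient are partial derivatives, so the entries are second partial
derivatives, and these commute. -/
theorem hessMatrix_transpose {f : E n → ℝ} {x : E n} (hf : ContDiffAt ℝ ∞ f x) :
    (hessMatrix f x)ᵀ = hessMatrix f x := by
  have hd : DifferentiableAt ℝ (fderiv ℝ f) x :=
    (hf.fderiv_right (m := ∞) (by simp)).differentiableAt (by simp)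
  have hg : DifferentiableAt ℝ (gradient f) x :=
    (contDiffAt_gradient hf).differentiableAt (by simp)
  have key : ∀ i j, hessMatrix f x i j =
      fderiv ℝ (fderiv ℝ f) x (EuclideanSpace.single j 1) (EuclideanSpace.single i 1) := by
    intro i j
    rw [hessMatrix_apply, hess]
    have h1 : HasFDerivAt (fun y => gradient f y i)
        ((PiLp.proj 2 (fun _ => ℝ) i : E n →L[ℝ] ℝ).comp (fderiv ℝ (gradient f) x)) x :=
      (PiLp.proj 2 (fun _ => ℝ) i : E n →L[ℝ] ℝ).hasFDerivAt.comp x hg.hasFDerivAt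
    have h2 := hd.hasFDerivAt.clm_apply
      (hasFDerivAt_const (EuclideanSpace.single i (1 : ℝ) : E n) x)
    have h3 := h1.unique (h2.congr_of_eventuallyEq (Eventually.of_forall fun y =>
      gradient_apply f y i))
    simpa using DFunLike.congr_fun h3 (EuclideanSpace.single j 1)
  ext i j
  rw [transpose_apply, key, key]
  exact (hf.isSymmSndFDerivAt (by simpa using WithTop.coe_le_coe.2 (le_top : (2 : ℕ∞) ≤ ⊤))).eq _ _

theorem det_toEuclideanCLM (M : Matrix (Fin n) (Fin n) ℝ) :
    (toEuclideanCLM (𝕜 := ℝ) (n := Fin n) M).det = M.det := by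
  rw [ContinuousLinearMap.det, coe_toEuclideanCLM_eq_toEuclideanLin,
    toEuclideanLin_eq_toLin_orthonormal, LinearMap.det_toLin]

theorem inverse_toEuclideanCLM {M : Matrix (Fin n) (Fin n) ℝ} (hM : M.det ≠ 0) :
    (toEuclideanCLM (𝕜 := ℝ) (n := Fin n) M).inverse =
      toEuclideanCLM (𝕜 := ℝ) (n := Fin n) M⁻¹ := by
  have hu : IsUnit M.det := isUnit_iff_ne_zero.2 hM
  apply ContinuousLinearMap.inverse_eq
  · change toEuclideanCLM (𝕜 := ℝ) (n := Fin n) M * toEuclideanCLM (𝕜 := ℝ) (n := Fin n) M⁻¹ = 1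
    rw [← map_mul, mul_nonsing_inv _ hu, map_one]
  · change toEuclideanCLM (𝕜 := ℝ) (n := Fin n) M⁻¹ * toEuclideanCLM (𝕜 := ℝ) (n := Fin n) M = 1
    rw [← map_mul, nonsing_inv_mul _ hu, map_one]

/-- The derivative of `x ↦ a(x) G(x) g(x)` at a zero of `g`. -/
theorem hasFDerivAt_smul_mulVec_of_eq_zero {a : E n → ℝ} {G : E n → Matrix (Fin n) (Fin n) ℝ}
    {g : E n → E n} {x : E n} {S : Matrix (Fin n) (Fin n) ℝ} (ha : DifferentiableAt ℝ a x)
    (hG : ∀ i j, DifferentiableAt ℝ (fun y => G y i j) x)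
    (hg : HasFDerivAt g (toEuclideanCLM (𝕜 := ℝ) (n := Fin n) S) x) (h0 : g x = 0) :
    HasFDerivAt (fun y => (WithLp.toLp 2 fun i => a y * ∑ j, G y i j * g y j : E n))
      (toEuclideanCLM (𝕜 := ℝ) (n := Fin n) (a x • (G x * S))) x := by
  rw [← hasFDerivWithinAt_univ, hasFDerivWithinAt_euclidean]
  intro i
  rw [hasFDerivWithinAt_univ]
  have h1 : ∀ j, HasFDerivAt (fun y => g y j)
      ((PiLp.proj 2 (fun _ => ℝ) j : E n →L[ℝ] ℝ).comp
        (toEuclideanCLM (𝕜 := ℝ) (n := Fin n) S)) x := fun j =>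
    (PiLp.proj 2 (fun _ => ℝ) j : E n →L[ℝ] ℝ).hasFDerivAt.comp x hg
  have h2 := ha.hasFDerivAt.fun_mul
    (HasFDerivAt.fun_sum (u := Finset.univ) fun j _ => (hG i j).hasFDerivAt.fun_mul (h1 j))
  refine h2.congr_fderiv ?_
  ext v
  -- The terms that differentiate `a` or `G` carry a factor `g x = 0`.
  simp only [h0, PiLp.zero_apply, mul_zero, Finset.sum_const_zero, zero_smul, add_zero]
  simp only [ContinuousLinearMap.comp_apply, PiLp.proj_apply, ofLp_toEuclideanCLM,
    _root_.smul_apply, _root_.sum_apply, smul_mulVec, ← mulVec_mulVec, Pi.smul_apply, smul_eq_mul]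
  rfl

end Calculus

/-! ### Derivative of a realized field at a regular equilibrium -/

namespace Realization

open Matrix Filter Topology

variable {m : ℕ} {Ω : Set (E (m + 2))} {X : E (m + 2) → E (m + 2)}

/-- The matrix whose rows are the gradients of the Casimir functions. -/
def casimirMatrix (R : Realization Ω X) (x : E (m + 2)) : Matrix (Fin m) (Fin (m + 2)) ℝ :=
  of fun k j => gradient (R.C k) x j

theorem contDiffAt_C (R : Realization Ω X) {x : E (m + 2)} (hx : x ∈ Ω) (k : Fin m) :
    ContDiffAt ℝ ∞ (R.C k) x := (R.smooth_C k).contDiffAt (R.isOpen.mem_nhds hx)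

theorem contDiffAt_H (R : Realization Ω X) {x : E (m + 2)} (hx : x ∈ Ω) :
    ContDiffAt ℝ ∞ R.H x := R.smooth_H.contDiffAt (R.isOpen.mem_nhds hx)

theorem contDiffAt_ν (R : Realization Ω X) {x : E (m + 2)} (hx : x ∈ Ω) :
    ContDiffAt ℝ ∞ R.ν x := R.smooth_ν.contDiffAt (R.isOpen.mem_nhds hx)

theorem contDiffAt_lagrangian (R : Realization Ω X) {xe x : E (m + 2)}
    (hreg : R.IsRegularEquilibrium xe) (hx : x ∈ Ω) : ContDiffAt ℝ ∞ (R.lagrangian hreg) x :=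
  (R.contDiffAt_H hx).add (ContDiffAt.sum fun k _ => contDiffAt_const.mul (R.contDiffAt_C hx k))

theorem gradient_lagrangian_apply (R : Realization Ω X) {xe x : E (m + 2)}
    (hreg : R.IsRegularEquilibrium xe) (hx : x ∈ Ω) (j : Fin (m + 2)) :
    gradient (R.lagrangian hreg) x j =
      gradient R.H x j + ∑ k, R.multiplier hreg k * gradient (R.C k) x j := by
  have hd : HasFDerivAt (R.lagrangian hreg)
      (fderiv ℝ R.H x + ∑ k, R.multiplier hreg k • fderiv ℝ (R.C k) x) x :=
    ((R.contDiffAt_H hx).differentiableAt (by simp)).hasFDerivAt.add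
      (HasFDerivAt.fun_sum fun k _ =>
        ((R.contDiffAt_C hx k).differentiableAt (by simp)).hasFDerivAt.const_mul _)
  simp only [gradient_apply, hd.fderiv]
  simp

/-- The vector field in terms of the gradient of the function `F_{λᵉ}`. -/
theorem field_eq_mulVec (R : Realization Ω X) {xe x : E (m + 2)}
    (hreg : R.IsRegularEquilibrium xe) (hx : x ∈ Ω) :
    X x = WithLp.toLp 2 fun i => R.ν x *
      ∑ j, pairingMatrix (R.casimirMatrix x) i j * gradient (R.lagrangian hreg) x j := by
  rw [R.field_eq x hx, hamiltonianField]
  congr 1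
  funext i
  have hc : (of fun k j => fderiv ℝ (R.C k) x (EuclideanSpace.single j 1)) =
      R.casimirMatrix x := by
    ext k j
    simp [casimirMatrix, gradient_apply]
  have hi : (fun j => fderiv ℝ (fun y : E (m + 2) => y i) x (EuclideanSpace.single j 1)) =
      Pi.single i 1 := by
    have : HasFDerivAt (fun y : E (m + 2) => y i)
        (PiLp.proj 2 (fun _ => ℝ) i : E (m + 2) →L[ℝ] ℝ) x :=
      (PiLp.proj 2 (fun _ => ℝ) i : E (m + 2) →L[ℝ] ℝ).hasFDerivAt
    funext j
    rw [this.fderiv]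
    simp [Pi.single_apply, eq_comm]
  rw [jacobianDet_snoc_snoc, hc, hi,
    ← stackDet_pair_add_sum _ _ _ (R.multiplier hreg), stackDet_single]
  congr 1
  refine Finset.sum_congr rfl fun j _ => ?_
  rw [gradient_lagrangian_apply R hreg hx]
  simp [casimirMatrix, gradient_apply]

theorem contDiffAt_pairingMatrix (R : Realization Ω X) {x : E (m + 2)} (hx : x ∈ Ω)
    (i j : Fin (m + 2)) :
    ContDiffAt ℝ ∞ (fun y => pairingMatrix (R.casimirMatrix y) i j) x := by
  simp only [pairingMatrix, of_apply, stackDet]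
  refine contDiffAt_det fun a b => ?_
  obtain ⟨s, rfl⟩ := finSumFinEquiv.surjective a
  rcases s with s | s
  · simp only [submatrix_apply, Equiv.symm_apply_apply, fromRows_apply_inl, casimirMatrix,
      of_apply, id]
    exact contDiffAt_euclidean.1 (contDiffAt_gradient (R.contDiffAt_C hx s)) b
  · simp only [submatrix_apply, Equiv.symm_apply_apply, fromRows_apply_inr]
    exact contDiffAt_const

/-- A realization does not assume `X` smooth; smoothness comes from the formula, and the existence
of a local flow rests on it. -/
theorem contDiffAt_field (R : Realization Ω X) {xe : E (m + 2)}
    (hreg : R.IsRegularEquilibrium xe) : ContDiffAt ℝ ∞ X xe := by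
  have hev : X =ᶠ[𝓝 xe] fun x => WithLp.toLp 2 fun i => R.ν x *
      ∑ j, pairingMatrix (R.casimirMatrix x) i j * gradient (R.lagrangian hreg) x j :=
    eventually_of_mem (R.isOpen.mem_nhds hreg.mem) fun x hx => R.field_eq_mulVec hreg hx
  refine ContDiffAt.congr_of_eventuallyEq ?_ hev
  rw [contDiffAt_euclidean]
  intro i
  exact (R.contDiffAt_ν hreg.mem).mul (ContDiffAt.sum fun j _ =>
    (R.contDiffAt_pairingMatrix hreg.mem i j).mul (contDiffAt_euclidean.1
      (contDiffAt_gradient (R.contDiffAt_lagrangian hreg hreg.mem)) j))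

theorem field_eq_zero (R : Realization Ω X) {xe : E (m + 2)}
    (hreg : R.IsRegularEquilibrium xe) : X xe = 0 := by
  rw [R.field_eq_mulVec hreg hreg.mem, R.gradient_lagrangian hreg]
  ext i
  simp

theorem hasFDerivAt_field (R : Realization Ω X) {xe : E (m + 2)}
    (hreg : R.IsRegularEquilibrium xe) :
    HasFDerivAt X (toEuclideanCLM (𝕜 := ℝ) (n := Fin (m + 2))
      (R.ν xe • (pairingMatrix (R.casimirMatrix xe) * hessMatrix (R.lagrangian hreg) xe))) xe := by
  have hev : X =ᶠ[𝓝 xe] fun x => WithLp.toLp 2 fun i => R.ν x *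
      ∑ j, pairingMatrix (R.casimirMatrix x) i j * gradient (R.lagrangian hreg) x j :=
    eventually_of_mem (R.isOpen.mem_nhds hreg.mem) fun x hx => R.field_eq_mulVec hreg hx
  refine HasFDerivAt.congr_of_eventuallyEq ?_ hev
  refine hasFDerivAt_smul_mulVec_of_eq_zero
    ((R.contDiffAt_ν hreg.mem).differentiableAt (by simp))
    (fun i j => (R.contDiffAt_pairingMatrix hreg.mem i j).differentiableAt (by simp)) ?_
    (R.gradient_lagrangian hreg)
  rw [toEuclideanCLM_hessMatrix]
  exact ((contDiffAt_gradient
    (R.contDiffAt_lagrangian hreg hreg.mem)).differentiableAt (by simp)).hasFDerivAt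

theorem linearIndependent_casimirMatrix (R : Realization Ω X) {xe : E (m + 2)}
    (hreg : R.IsRegularEquilibrium xe) : LinearIndependent ℝ (R.casimirMatrix xe).row :=
  hreg.indep.map' (WithLp.linearEquiv 2 ℝ (Fin (m + 2) → ℝ)).toLinearMap (LinearEquiv.ker _)

/-- Symmetry of the Hessian lets its inverse act on the rows of the Casimir matrix from the right.
-/
theorem invariant_eq (R : Realization Ω X) {xe : E (m + 2)}
    (hreg : R.IsRegularEquilibrium xe) (hnd : R.IsNondegenerate hreg) :
    R.invariant hreg = R.ν xe ^ 2 * (hessMatrix (R.lagrangian hreg) xe).det *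
      (R.casimirMatrix xe * (hessMatrix (R.lagrangian hreg) xe)⁻¹ *
        (R.casimirMatrix xe)ᵀ).det := by
  have hsym := hessMatrix_transpose (R.contDiffAt_lagrangian hreg hreg.mem)
  rw [IsNondegenerate, ← toEuclideanCLM_hessMatrix, det_toEuclideanCLM] at hnd
  rw [invariant, ← toEuclideanCLM_hessMatrix, det_toEuclideanCLM, inverse_toEuclideanCLM hnd,
    wedgeInner]
  congr 2
  set S := hessMatrix (R.lagrangian hreg) xe
  ext i j
  have hrow : ∀ l, (R.casimirMatrix xe * S⁻¹) i l = (S⁻¹ *ᵥ (gradient (R.C i) xe).ofLp) l := by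
    intro l
    have hSt : S⁻¹ᵀ = S⁻¹ := by rw [transpose_nonsing_inv, hsym]
    rw [mul_apply, mulVec, dotProduct]
    refine Finset.sum_congr rfl fun k _ => ?_
    conv_rhs => rw [← hSt]
    rw [transpose_apply, casimirMatrix, of_apply, mul_comm]
  rw [of_apply, PiLp.inner_apply, mul_apply]
  refine Finset.sum_congr rfl fun l _ => ?_
  rw [hrow, ofLp_toEuclideanCLM]
  simp [casimirMatrix, mul_comm]

/-- At a non-degenerate regular equilibrium the derivative of the vector field factors through a
plane, on which it is traceless with determinant the invariant. -/
theorem exists_hasFDerivAt_rank_two (R : Realization Ω X) {xe : E (m + 2)}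
    (hreg : R.IsRegularEquilibrium xe) (hnd : R.IsNondegenerate hreg) :
    ∃ (U : Matrix (Fin (m + 2)) (Fin 2) ℝ) (V : Matrix (Fin 2) (Fin (m + 2)) ℝ),
      HasFDerivAt X (toEuclideanCLM (𝕜 := ℝ) (n := Fin (m + 2)) (U * V)) xe ∧
        (V * U).trace = 0 ∧ (V * U).det = R.invariant hreg := by
  have hdet := hnd
  rw [IsNondegenerate, ← toEuclideanCLM_hessMatrix, det_toEuclideanCLM] at hdet
  obtain ⟨U, V, hUV, htr, hd⟩ := exists_rank_two_factorization _
    (R.linearIndependent_casimirMatrix hreg) _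
    (hessMatrix_transpose (R.contDiffAt_lagrangian hreg hreg.mem)) hdet (R.ν xe)
  refine ⟨U, V, ?_, htr, hd.trans (R.invariant_eq hreg hnd).symm⟩
  rw [← hUV]
  exact R.hasFDerivAt_field hreg

/-- The left side knows only the derivative of `X`, the right side the realization; comparing two
realizations gives independence. -/
theorem det_sub_smul_id (R : Realization Ω X) {xe : E (m + 2)}
    (hreg : R.IsRegularEquilibrium xe) (hnd : R.IsNondegenerate hreg)
    {A : E (m + 2) →L[ℝ] E (m + 2)} (hA : HasFDerivAt X A xe) (μ : ℝ) :
    (A - μ • ContinuousLinearMap.id ℝ (E (m + 2))).det =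
      (-μ) ^ m * (μ ^ 2 + R.invariant hreg) := by
  obtain ⟨U, V, hd, htr, hdet⟩ := R.exists_hasFDerivAt_rank_two hreg hnd
  have : A - μ • ContinuousLinearMap.id ℝ (E (m + 2)) =
      toEuclideanCLM (𝕜 := ℝ) (n := Fin (m + 2)) (U * V - μ • 1) := by
    rw [hA.unique hd, map_sub, map_smul, map_one]
    rfl
  rw [this, det_toEuclideanCLM, det_sub_smul_of_rank_two U V htr, hdet]

theorem cube_apply (R : Realization Ω X) {xe : E (m + 2)}
    (hreg : R.IsRegularEquilibrium xe) (hnd : R.IsNondegenerate hreg)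
    {A : E (m + 2) →L[ℝ] E (m + 2)} (hA : HasFDerivAt X A xe) (y : E (m + 2)) :
    A (A (A y)) = -R.invariant hreg • A y := by
  obtain ⟨U, V, hd, htr, hdet⟩ := R.exists_hasFDerivAt_rank_two hreg hnd
  have h := congrArg (toEuclideanCLM (𝕜 := ℝ) (n := Fin (m + 2))) (cube_of_rank_two U V htr)
  rw [map_mul, map_mul, map_smul, ← hA.unique hd, hdet] at h
  exact DFunLike.congr_fun h y

theorem isUnstableEquilibrium (R : Realization Ω X) {xe : E (m + 2)}
    (hreg : R.IsRegularEquilibrium xe) (hnd : R.IsNondegenerate hreg)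
    (hneg : R.invariant hreg < 0) : IsUnstableEquilibrium Ω X xe := by
  refine ⟨R.field_eq_zero hreg, ?_⟩
  have hA := R.hasFDerivAt_field hreg
  set A := toEuclideanCLM (𝕜 := ℝ) (n := Fin (m + 2))
    (R.ν xe • (pairingMatrix (R.casimirMatrix xe) * hessMatrix (R.lagrangian hreg) xe))
  -- A root of the characteristic polynomial, hence an eigenvalue.
  set lam := √(-R.invariant hreg)
  have hlam : 0 < lam := Real.sqrt_pos.2 (by linarith)
  have hsq : lam ^ 2 = -R.invariant hreg := Real.sq_sqrt (by linarith)
  have hdet : LinearMap.det (A - lam • ContinuousLinearMap.id ℝ (E (m + 2)) :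
      E (m + 2) →L[ℝ] E (m + 2)).toLinearMap = 0 := by
    have := R.det_sub_smul_id hreg hnd hA lam
    rw [hsq, neg_add_cancel, mul_zero] at this
    exact this
  obtain ⟨v, hv, hv0⟩ := Submodule.exists_mem_ne_zero_of_ne_bot
    (LinearMap.bot_lt_ker_of_det_eq_zero hdet).ne'
  refine not_isLyapunovStable_of_cube_eq (R.isOpen.mem_nhds hreg.mem) (R.field_eq_zero hreg) hA
    hlam (fun y => by rw [hsq]; exact R.cube_apply hreg hnd hA y) hv0 ?_
  exact sub_eq_zero.1 (LinearMap.mem_ker.1 hv)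

end Realization

end CompletelyIntegrable

end

/-! ### The main theorem -/

theorem theorem5p4 {m : ℕ}
    (Ω : Set (CompletelyIntegrable.E (m + 2)))
    (X : CompletelyIntegrable.E (m + 2) → CompletelyIntegrable.E (m + 2))
    (R : CompletelyIntegrable.Realization Ω X)
    (xe : CompletelyIntegrable.E (m + 2))
    (hreg : R.IsRegularEquilibrium xe)
    (hnd : R.IsNondegenerate hreg) :
    -- the linearization exists, is unique, and has the stated characteristic polynomial
    (∃! L : CompletelyIntegrable.E (m + 2) →L[ℝ] CompletelyIntegrable.E (m + 2),
      CompletelyIntegrable.IsLinearizationAt Ω X xe L) ∧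
    (∀ L : CompletelyIntegrable.E (m + 2) →L[ℝ] CompletelyIntegrable.E (m + 2),
      CompletelyIntegrable.IsLinearizationAt Ω X xe L →
        ∀ μ : ℝ, (L - μ • ContinuousLinearMap.id ℝ (CompletelyIntegrable.E (m + 2))).det
          = (-μ) ^ m * (μ ^ 2 + R.invariant hreg)) ∧
    -- the invariant is the same for every other realization of `X` around `xe`
    (∀ (Ω' : Set (CompletelyIntegrable.E (m + 2)))
      (R' : CompletelyIntegrable.Realization Ω' X)
      (hreg' : R'.IsRegularEquilibrium xe), R'.IsNondegenerate hreg' →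
        R'.invariant hreg' = R.invariant hreg) ∧
    -- instability
    (R.invariant hreg < 0 → CompletelyIntegrable.IsUnstableEquilibrium Ω X xe) := by
  have hX := R.field_eq_zero hreg
  have hA := R.hasFDerivAt_field hreg
  have hc : ContDiffAt ℝ 1 X xe := (R.contDiffAt_field hreg).of_le (by simp)
  refine ⟨⟨_, CompletelyIntegrable.isLinearizationAt_of_hasFDerivAt
    (R.isOpen.mem_nhds hreg.mem) hX hc hA, fun L hL => hL.eq hX hA⟩, fun L hL μ => ?_,
    fun Ω' R' hreg' hnd' => ?_, R.isUnstableEquilibrium hreg hnd⟩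
  · exact R.det_sub_smul_id hreg hnd (hL.eq hX hA ▸ hA) μ
  -- Both realizations are evaluated on the same derivative; at `μ = 1` the factor `(-μ) ^ m` is
  -- nonzero and cancels.
  · have h := (R'.det_sub_smul_id hreg' hnd' hA 1).symm.trans (R.det_sub_smul_id hreg hnd hA 1)
    exact add_left_cancel (mul_left_cancel₀ (by simp) h)
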